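/- Let $q>2$ and $n\ge 0$ be integers. Consider the $q$-ary $n$-dimensional Hamming graph: its vertices are the words of length $n$ over $\mathbb{Z}/q$, and two words are adjacent iff they differ in exactly one position. Let $D$ be its adjacency matrix. Let $W_d$ and $B_d$ be the sphere and the ball of radius $d$ (in Hamming distance) centred at the zero word. Let $0\le d\le h\le n$ and let $\lambda=(q-1)n-qh$ be the eigenvalue with index $h$; a $\lambda$-function is a function $f$ from the vertices to $\mathbb{C}$ with $Df=\lambda f$. For an integer $Q\ge 2$ put $P^{(Q)}_i(t;N)=\sum_{j=0}^{i}(-1)^j(Q-1)^{i-j}\binom{t}{j}\binom{N-t}{i-j}$. For $0\le k\le h$, $0\le i\le k$ and $0\le j\le n-k$ define $r^k_{ij}$ as follows (empty sums are $0$). If $k\le n-h$, then $$r^k_{ij}=(-1)^i\sum_{l=0}^{j-i}P^{(q)}_{j-i-l}(h-k;\,n-2k)\,(q-2)^l\binom{k-i}{l}.$$ If $k>n-h$, let $U=(u_{ab})_{a,b=0}^{n-k}$ be the lower unitriangular matrix with $u_{ab}=(q-1)^{a-b}\binom{h+k-n}{a-b}$ for $a\ge b$ and $u_{ab}=0$ for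 $a<b$, let $u'_{ab}$ be the entries of $U^{-1}$, and put $$r^k_{ij}=(-1)^i\sum_{s=i}^{j}u'_{js}\,P^{(q-1)}_{s-i}(h-k;\,h-i).$$ Suppose that $$\sum_{i=0}^{k} r^k_{i,d-k}\,P^{(q-1)}_i(l;k)\neq 0\qquad\text{for all } k=0,\ldots,d \text{ and } l=0,\ldots,k .$$ Then for every function $\varphi:W_d\to\mathbb{C}$ and every $\lambda$-function $f$ with $f(\alpha)=\varphi(\alpha)$ for all $\alpha\in W_d$, the values of $f$ at all vertices of $B_d$ are uniquely determined by $\varphi$; that is, any two $\lambda$-functions that coincide with $\varphi$ on $W_d$ coincide on $B_d$. -/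

import Mathlib

/-- The `q`-ary `n`-dimensional hypercube (Hamming graph): the vertices are the words of length `n`
over `ZMod q`, and two words are adjacent when they differ in exactly one position. -/
def qaryCube (q n : ℕ) : SimpleGraph (Fin n → ZMod q) where
  Adj α β := hammingDist α β = 1
  symm := ⟨fun α β h => by rw [hammingDist_comm]; exact h⟩
  loopless := ⟨fun α h => by simp at h⟩

instance qaryCubeDecidableAdj (q n : ℕ) : DecidableRel (qaryCube q n).Adj :=
  fun α β => inferInstanceAs (Decidable (hammingDist α β = 1))

/-- `f` is a `μ`-function of the hypercube: `D f = μ f`, with `D` the adjacency matrix.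
(The zero function is allowed.) -/
def IsEigenfunction (q n : ℕ) [NeZero q] (μ : ℂ) (f : (Fin n → ZMod q) → ℂ) : Prop :=
  ((qaryCube q n).adjMatrix ℂ).mulVec f = μ • f

/-- The sphere of radius `d` centred at the zero word. -/
def zeroSphere (q n d : ℕ) : Set (Fin n → ZMod q) := {α | hammingDist α 0 = d}

/-- The ball of radius `d` centred at the zero word. -/
def zeroBall (q n d : ℕ) : Set (Fin n → ZMod q) := {α | hammingDist α 0 ≤ d}

/-- The value `P_i^{(q)}(t; N)` of the Krawtchouk polynomial at an integer `0 ≤ t ≤ N`. -/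
noncomputable def krawtchouk (q i t N : ℕ) : ℂ :=
  ∑ j ∈ Finset.range (i + 1),
    (-1 : ℂ) ^ j * ((q : ℂ) - 1) ^ (i - j) * (t.choose j : ℂ) * ((N - t).choose (i - j) : ℂ)

/-- The coefficient `r_{ij}^k` in the case `k ≤ min {h, n - h}`. The sum over
`0 ≤ l ≤ j - i` is empty when `j < i`. -/
noncomputable def localCoeffLow (q n h k i j : ℕ) : ℂ :=
  (-1 : ℂ) ^ i * ∑ l ∈ Finset.range (j + 1 - i),
    krawtchouk q (j - i - l) (h - k) (n - 2 * k) * ((q : ℂ) - 2) ^ l * ((k - i).choose l : ℂ)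

/-- The lower unitriangular matrix `U = (u_{ji})`, with `0 ≤ i, j ≤ n - k` and
`u_{ji} = (q-1)^{j-i} * binom (h+k-n) (j-i)`, used in the case `n - h < k ≤ h`. -/
noncomputable def localMatrix (q n h k : ℕ) : Matrix (Fin (n - k + 1)) (Fin (n - k + 1)) ℂ :=
  Matrix.of fun j i =>
    if i ≤ j then
      ((q : ℂ) - 1) ^ ((j : ℕ) - (i : ℕ)) * ((h + k - n).choose ((j : ℕ) - (i : ℕ)) : ℂ)
    else 0

/-- The entry `u'_{js}` of `U⁻¹` (`0` outside of the index range `0 ≤ j, s ≤ n - k`). -/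
noncomputable def localMatrixInv (q n h k j s : ℕ) : ℂ :=
  if hjs : j < n - k + 1 ∧ s < n - k + 1 then
    (localMatrix q n h k)⁻¹ ⟨j, hjs.1⟩ ⟨s, hjs.2⟩
  else 0

/-- The coefficient `r_{ij}^k` in the case `n - h < k ≤ h`. -/
noncomputable def localCoeffHigh (q n h k i j : ℕ) : ℂ :=
  (-1 : ℂ) ^ i * ∑ s ∈ Finset.Icc i j,
    localMatrixInv q n h k j s * krawtchouk (q - 1) (s - i) (h - k) (h - i)

/-- The coefficient `r_{ij}^k`: the first formula if `k ≤ n - h`, the second if `k > n - h`. -/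
noncomputable def localCoeff (q n h k i j : ℕ) : ℂ :=
  if k + h ≤ n then localCoeffLow q n h k i j else localCoeffHigh q n h k i j

/-! By linearity it suffices that a `μ`-function `f` vanishing on the sphere of radius `d` vanishes
on the ball. Such an `f` lies in the span of products of `h` zero-sum functions of one coordinate
each (`mem_pureSpan_of_sphereSum_one`). On a product over a coordinate set `S`, summing over a
sphere inside a face with free coordinates `J` is multiplication by a Krawtchouk value depending on
`S` only through `|S ∩ J|`. Since `|S| = h`, the number `w = |S ∩ I|` governs both `J = I` and `J =
Iᶜ`. The coefficients `r` express sphere sums along `Iᶜ` through those along `I`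
(`sphereSum_compl_eq`), by the generating-function identity `sum_localCoeff_mul_krawtchouk`. Now
induct on the weight `k` of a word with support `I`. Its sphere sum of radius `d - k` along `Iᶜ`
runs over words of weight `d`, so it is zero. In the sums along `I`, words of weight below `k` drop
out by induction, leaving an operator on the `(q-1)`-ary cube of words with support exactly `I`. Its
eigenvalues are the sums assumed nonzero, so it is injective and `f` vanishes there. -/

/-! ### Generating polynomials of Krawtchouk values -/

open Polynomial in
theorem coeff_one_add_C_mul_X_pow (a : ℂ) (n i : ℕ) :
    ((1 + C a * X : ℂ[X]) ^ n).coeff i = a ^ i * (n.choose i : ℂ) := by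
  have : (1 + C a * X : ℂ[X]) ^ n = ((1 + X) ^ n : ℂ[X]).comp (C a * X) := by simp
  rw [this, comp_C_mul_X_coeff, coeff_one_add_X_pow, mul_comm]

open Polynomial in
/-- The generating polynomial of the Krawtchouk values `P_i^{(q)}(t; N)` with `N = t + m`. -/
noncomputable def krawtchoukPoly (q t m : ℕ) : ℂ[X] :=
  (1 - X) ^ t * (1 + C ((q : ℂ) - 1) * X) ^ m

open Polynomial in
theorem krawtchouk_eq_coeff (q i t N : ℕ) :
    krawtchouk q i t N = (krawtchoukPoly q t (N - t)).coeff i := by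
  have h1 : (1 - X : ℂ[X]) = 1 + C (-1) * X := by simp [sub_eq_add_neg]
  rw [krawtchoukPoly, h1, coeff_mul, Finset.Nat.sum_antidiagonal_eq_sum_range_succ_mk, krawtchouk]
  refine Finset.sum_congr rfl fun j _ => ?_
  simp only [coeff_one_add_C_mul_X_pow]
  ring

open Polynomial in
theorem natDegree_krawtchoukPoly_le (q t m : ℕ) : (krawtchoukPoly q t m).natDegree ≤ t + m := by
  unfold krawtchoukPoly
  refine natDegree_mul_le.trans (Nat.add_le_add ?_ ?_)
  · refine (natDegree_pow_le_of_le (m := 1) t ?_).trans (by simp)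
    compute_degree
  · refine (natDegree_pow_le_of_le (m := 1) m ?_).trans (by simp)
    compute_degree

open Polynomial in
theorem sum_krawtchouk_mul_pow (q : ℕ) {w k : ℕ} (hw : w ≤ k) (x y : ℂ) (hy : y ≠ 0) :
    ∑ i ∈ Finset.range (k + 1), krawtchouk q i w k * x ^ i * y ^ (k - i) =
      (y - x) ^ w * (y + ((q : ℂ) - 1) * x) ^ (k - w) := by
  have hdeg : (krawtchoukPoly q w (k - w)).natDegree < k + 1 := by
    have := natDegree_krawtchoukPoly_le q w (k - w)
    omega
  have hev := eval_eq_sum_range' hdeg (x / y)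
  have hpoly : y ^ k * (krawtchoukPoly q w (k - w)).eval (x / y) =
      (y - x) ^ w * (y + ((q : ℂ) - 1) * x) ^ (k - w) := by
    have hk : y ^ k = y ^ w * y ^ (k - w) := by rw [← pow_add]; congr 1; omega
    rw [hk, krawtchoukPoly]
    simp only [eval_mul, eval_pow, eval_sub, eval_add, eval_one, eval_X, eval_C]
    rw [mul_mul_mul_comm, ← mul_pow, ← mul_pow]
    congr 2 <;> field_simp
  rw [← hpoly, hev, Finset.mul_sum]
  refine Finset.sum_congr rfl fun i hi => ?_
  rw [krawtchouk_eq_coeff]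
  have hk : y ^ k = y ^ i * y ^ (k - i) := by
    rw [← pow_add]; congr 1; have := Finset.mem_range.1 hi; omega
  rw [hk, div_pow]
  field_simp

-- This is the homogeneous identity at `x = -X`, `y = 1 + (q-2)X`, for which `y - x = 1 + (q-1)X`
-- and `y + (q-1)x = 1 - X`.
open Polynomial in
theorem sum_krawtchouk_mul_neg_X_pow (q : ℕ) {w k : ℕ} (hw : w ≤ k) :
    ∑ i ∈ Finset.range (k + 1),
        C (krawtchouk q i w k) * ((-X) ^ i * (1 + C ((q : ℂ) - 2) * X) ^ (k - i)) =
      (1 + C ((q : ℂ) - 1) * X) ^ w * (1 - X : ℂ[X]) ^ (k - w) := by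
  refine eq_of_infinite_eval_eq _ _ ?_
  -- These points have `y = 0` and are excluded by the homogeneous identity; for `q = 2` there are
  -- none.
  have hfin : Set.Finite {z : ℂ | 1 + ((q : ℂ) - 2) * z = 0} := by
    refine Set.Subsingleton.finite fun a ha b hb => ?_
    simp only [Set.mem_ofPred_eq] at ha hb
    have hq : ((q : ℂ) - 2) ≠ 0 := by rintro h0; simp [h0] at ha
    exact mul_left_cancel₀ hq (by linear_combination ha - hb)
  refine hfin.infinite_compl.mono fun z hz => ?_
  have := sum_krawtchouk_mul_pow q hw (-z) (1 + ((q : ℂ) - 2) * z) hz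
  simp only [Set.mem_ofPred_eq, eval_finsetSum, eval_mul, eval_pow, eval_sub, eval_add, eval_one,
    eval_X, eval_C, eval_neg]
  simp only [mul_assoc] at this ⊢
  rw [this]
  congr 2 <;> ring

/-! ### The coefficients `r` as transition coefficients -/

-- `r` is the `X^j` coefficient of `(-X)^i (1+(q-2)X)^(k-i) (1-X)^(h-k) (1+(q-1)X)^(n-h-k)`. The
-- last two factors do not depend on `i`, so the preceding identity applies.
open Polynomial in
theorem sum_localCoeffLow_mul_krawtchouk (q : ℕ) {n h k w : ℕ} (hw : w ≤ k)
    (hk : k ≤ h) (hkn : k + h ≤ n) (j : ℕ) :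
    ∑ i ∈ Finset.range (k + 1), localCoeffLow q n h k i j * krawtchouk q i w k =
      krawtchouk q j (h - w) (n - k) := by
  have hr : ∀ i, localCoeffLow q n h k i j =
      ((-X) ^ i * (1 + C ((q : ℂ) - 2) * X) ^ (k - i) *
        krawtchoukPoly q (h - k) (n - 2 * k - (h - k)) : ℂ[X]).coeff j := by
    intro i
    rw [neg_pow, localCoeffLow]
    have h1 : ((-1 : ℂ[X]) ^ i * X ^ i * (1 + C ((q : ℂ) - 2) * X) ^ (k - i) *
        krawtchoukPoly q (h - k) (n - 2 * k - (h - k))) = C ((-1) ^ i) *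
        (((1 + C ((q : ℂ) - 2) * X) ^ (k - i) *
        krawtchoukPoly q (h - k) (n - 2 * k - (h - k))) * X ^ i) := by
      simp only [map_pow, map_neg, map_one]; ring
    rw [h1, coeff_C_mul, coeff_mul_X_pow']
    split_ifs with hij
    · congr 1
      rw [coeff_mul, Finset.Nat.sum_antidiagonal_eq_sum_range_succ_mk,
        show j + 1 - i = (j - i).succ by omega]
      refine Finset.sum_congr rfl fun l _ => ?_
      rw [coeff_one_add_C_mul_X_pow, krawtchouk_eq_coeff]
      ring
    · rw [show j + 1 - i = 0 by omega]; simp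
  rw [krawtchouk_eq_coeff]
  have key : krawtchoukPoly q (h - w) (n - k - (h - w)) =
      ∑ i ∈ Finset.range (k + 1), C (krawtchouk q i w k) *
        ((-X) ^ i * (1 + C ((q : ℂ) - 2) * X) ^ (k - i) *
        krawtchoukPoly q (h - k) (n - 2 * k - (h - k))) := by
    simp only [← mul_assoc]
    rw [← Finset.sum_mul]
    simp only [mul_assoc]
    rw [sum_krawtchouk_mul_neg_X_pow q hw, krawtchoukPoly, krawtchoukPoly,
      show h - w = (k - w) + (h - k) by omega,
      show n - k - ((k - w) + (h - k)) = w + (n - 2 * k - (h - k)) by omega, pow_add, pow_add]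
    ring
  rw [key, finsetSum_coeff]
  refine Finset.sum_congr rfl fun i _ => ?_
  rw [hr, coeff_C_mul, mul_comm]

theorem localMatrix_det (q n h k : ℕ) : (localMatrix q n h k).det = 1 := by
  rw [Matrix.det_of_isLowerTriangular]
  · simp [localMatrix]
  · intro i j hij
    have hij : i < j := hij
    simp [localMatrix, not_le.2 hij]

theorem localMatrix_inv_apply_of_lt (q n h k : ℕ) {i j : Fin (n - k + 1)} (hij : i < j) :
    (localMatrix q n h k)⁻¹ i j = 0 := by
  have hU : (localMatrix q n h k).BlockTriangular OrderDual.toDual := by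
    intro a b hab
    have hab : a < b := hab
    simp [localMatrix, not_le.2 hab]
  have : Invertible (localMatrix q n h k) :=
    Matrix.invertibleOfIsUnitDet _ (by rw [localMatrix_det]; exact isUnit_one)
  exact Matrix.blockTriangular_inv_of_blockTriangular hU hij

-- `U` is multiplication by `(1+(q-1)X)^(h+k-n)` on coefficients of degree at most `n-k`. Hence
-- `U⁻¹` replaces the factor `(1+(q-1)X)^(n-h-k)` when its exponent is negative.
open Polynomial in
theorem localMatrix_mulVec_coeff (q n h k : ℕ) (p : ℂ[X]) (s : Fin (n - k + 1)) :
    (localMatrix q n h k).mulVec (fun j => p.coeff j) s =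
      (p * (1 + C ((q : ℂ) - 1) * X) ^ (h + k - n)).coeff s := by
  rw [coeff_mul, Finset.Nat.sum_antidiagonal_eq_sum_range_succ_mk, Matrix.mulVec, dotProduct]
  have h1 := Fin.sum_univ_eq_sum_range (fun i => (if i ≤ s then ((q : ℂ) - 1) ^ ((s : ℕ) - i) *
    ((h + k - n).choose ((s : ℕ) - i) : ℂ) else 0) * p.coeff i) (n - k + 1)
  have h2 : ∑ x, localMatrix q n h k s x * p.coeff x = ∑ i : Fin (n - k + 1),
      (if (i : ℕ) ≤ s then ((q : ℂ) - 1) ^ ((s : ℕ) - i) *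
    ((h + k - n).choose ((s : ℕ) - i) : ℂ) else 0) * p.coeff i := by
    simp [localMatrix]
  rw [h2, h1]
  symm
  have hs := s.2
  refine Finset.sum_subset_zero_on_sdiff (fun i hi => ?_) (fun i hi => ?_) (fun i hi => ?_)
  · simp only [Finset.mem_range] at hi ⊢; omega
  · simp only [Finset.mem_sdiff, Finset.mem_range] at hi
    rw [if_neg (by omega), zero_mul]
  · simp only [Finset.mem_range] at hi
    rw [if_pos (by omega), coeff_one_add_C_mul_X_pow, mul_comm]

open Polynomial in
theorem localCoeffHigh_eq_mulVec (q : ℕ) (hq : 1 ≤ q) {n h k i : ℕ} (hik : i ≤ k) (hk : k ≤ h)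
    (j : Fin (n - k + 1)) :
    localCoeffHigh q n h k i j = (localMatrix q n h k)⁻¹.mulVec
      (fun s => ((-X) ^ i * (1 + C ((q : ℂ) - 2) * X) ^ (k - i) *
        (1 - X) ^ (h - k) : ℂ[X]).coeff s) j := by
  have hp : ∀ s : ℕ, ((-X) ^ i * (1 + C ((q : ℂ) - 2) * X) ^ (k - i) *
        (1 - X) ^ (h - k) : ℂ[X]).coeff s =
      if i ≤ s then (-1) ^ i * krawtchouk (q - 1) (s - i) (h - k) (h - i) else 0 := by
    intro s
    have h1 : ((-X) ^ i * (1 + C ((q : ℂ) - 2) * X) ^ (k - i) * (1 - X) ^ (h - k) : ℂ[X]) =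
        C ((-1) ^ i) * (krawtchoukPoly (q - 1) (h - k) (h - i - (h - k)) * X ^ i) := by
      rw [krawtchoukPoly, neg_pow, show h - i - (h - k) = k - i by omega, Nat.cast_sub hq,
        show (q : ℂ) - (1 : ℕ) - 1 = q - 2 by push_cast; ring]
      simp only [map_pow, map_neg, map_one]; ring
    rw [h1, coeff_C_mul, coeff_mul_X_pow', krawtchouk_eq_coeff, mul_ite, mul_zero]
  rw [Matrix.mulVec, dotProduct, localCoeffHigh, Finset.mul_sum]
  have h1 := Fin.sum_univ_eq_sum_range (fun s => localMatrixInv q n h k j s *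
    (if i ≤ s then (-1) ^ i * krawtchouk (q - 1) (s - i) (h - k) (h - i) else 0)) (n - k + 1)
  have h2 : ∀ s : Fin (n - k + 1), localMatrixInv q n h k j s = (localMatrix q n h k)⁻¹ j s := by
    intro s
    rw [localMatrixInv, dif_pos ⟨j.2, s.2⟩]
  simp only [hp, ← h2]
  rw [h1]
  refine Finset.sum_subset_zero_on_sdiff (fun s hs => ?_) (fun s hs => ?_) (fun s hs => ?_)
  · simp only [Finset.mem_range, Finset.mem_Icc] at hs ⊢; omega
  · simp only [Finset.mem_sdiff, Finset.mem_range, Finset.mem_Icc, not_and, not_le] at hs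
    split_ifs with his
    · rw [h2 ⟨s, hs.1⟩, localMatrix_inv_apply_of_lt _ _ _ _ (hs.2 his), zero_mul]
    · simp
  · simp only [Finset.mem_Icc] at hs
    rw [if_pos hs.1]; ring

open Polynomial in
theorem sum_localCoeffHigh_mul_krawtchouk (q : ℕ) (hq : 1 ≤ q) {n h k w : ℕ} (hw : w ≤ k)
    (hk : k ≤ h) (hkn : n ≤ k + h) (hwn : h - w ≤ n - k) (hn : k ≤ n) (j : Fin (n - k + 1)) :
    ∑ i ∈ Finset.range (k + 1), localCoeffHigh q n h k i j * krawtchouk q i w k =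
      krawtchouk q j (h - w) (n - k) := by
  set U := localMatrix q n h k with hU
  let v : ℕ → Fin (n - k + 1) → ℂ := fun i s => ((-X) ^ i * (1 + C ((q : ℂ) - 2) * X) ^ (k - i) *
        (1 - X) ^ (h - k) : ℂ[X]).coeff s
  have h1 : ∀ i ∈ Finset.range (k + 1), localCoeffHigh q n h k i j * krawtchouk q i w k =
      U⁻¹.mulVec (krawtchouk q i w k • v i) j := by
    intro i hi
    rw [localCoeffHigh_eq_mulVec q hq (by simpa [Nat.lt_succ_iff] using hi) hk, Matrix.mulVec_smul,
      Pi.smul_apply, smul_eq_mul, mul_comm]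
  rw [Finset.sum_congr rfl h1, ← Finset.sum_apply, ← Matrix.mulVec_sum]
  have h2 : ∑ i ∈ Finset.range (k + 1), krawtchouk q i w k • v i =
      U.mulVec (fun j => (krawtchoukPoly q (h - w) (n - k - (h - w))).coeff j) := by
    ext s
    rw [hU, localMatrix_mulVec_coeff]
    simp only [Finset.sum_apply, Pi.smul_apply, v, smul_eq_mul]
    have key : krawtchoukPoly q (h - w) (n - k - (h - w)) *
          (1 + C ((q : ℂ) - 1) * X) ^ (h + k - n) =
        ∑ i ∈ Finset.range (k + 1), C (krawtchouk q i w k) *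
        ((-X) ^ i * (1 + C ((q : ℂ) - 2) * X) ^ (k - i) * (1 - X) ^ (h - k)) := by
      simp only [← mul_assoc]
      rw [← Finset.sum_mul]
      simp only [mul_assoc]
      -- By `hwn` the natural subtraction is exact, so the exponents of `1+(q-1)X` add up to `w`.
      rw [sum_krawtchouk_mul_neg_X_pow q hw, krawtchoukPoly, mul_assoc, ← pow_add,
        show n - k - (h - w) + (h + k - n) = w by omega,
        show h - w = (k - w) + (h - k) by omega, pow_add]
      ring
    rw [key, finsetSum_coeff]
    simp only [coeff_C_mul]
  rw [h2, Matrix.mulVec_mulVec, Matrix.nonsing_inv_mul _ (by rw [hU, localMatrix_det]; simp),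
    Matrix.one_mulVec, krawtchouk_eq_coeff]

theorem sum_localCoeff_mul_krawtchouk (q : ℕ) (hq : 1 ≤ q) {n h k w j : ℕ} (hw : w ≤ k)
    (hk : k ≤ h) (hwn : h - w ≤ n - k) (hn : k ≤ n) (hj : j ≤ n - k) :
    ∑ i ∈ Finset.range (k + 1), localCoeff q n h k i j * krawtchouk q i w k =
      krawtchouk q j (h - w) (n - k) := by
  unfold localCoeff
  split_ifs with hkn
  · exact sum_localCoeffLow_mul_krawtchouk q hw hk hkn j
  · exact sum_localCoeffHigh_mul_krawtchouk q hq hw hk (by omega) hwn hn ⟨j, by omega⟩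

/-! ### Sphere sums on faces and their eigenfunctions -/

/-- The operator sending `f` to its sums over the words at distance `j` from `x` which agree with
`x` outside `J`. -/
def sphereSum {ι A : Type*} [Fintype ι] [DecidableEq ι] [Fintype A] [DecidableEq A]
    (J : Finset ι) (j : ℕ) : ((ι → A) → ℂ) →ₗ[ℂ] ((ι → A) → ℂ) where
  toFun f x := ∑ z with (∀ i, i ∉ J → z i = x i) ∧ hammingDist x z = j, f z
  map_add' f g := by ext x; simp [Finset.sum_add_distrib]
  map_smul' c f := by ext x; simp [Finset.mul_sum]

theorem sphereSum_apply {ι A : Type*} [Fintype ι] [DecidableEq ι] [Fintype A] [DecidableEq A]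
    (J : Finset ι) (j : ℕ) (f : (ι → A) → ℂ) (x : ι → A) :
    sphereSum J j f x = ∑ z with (∀ i, i ∉ J → z i = x i) ∧ hammingDist x z = j, f z := rfl

/-- The product function `x ↦ ∏ i ∈ S, φ i (x i)`. -/
def pureFun {ι A : Type*} (S : Finset ι) (φ : ι → A → ℂ) : (ι → A) → ℂ :=
  fun x => ∏ i ∈ S, φ i (x i)

-- All radii are treated at once: the sum factors over coordinates. As `φ i` has zero sum, a
-- coordinate of `S ∩ J` gives `φ i (x i) (1 - X)`, while one of `J \ S` gives `1 + (q-1)X`.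
open Polynomial in
theorem sum_pureFun_mul_X_pow {ι A : Type*} [Fintype ι] [DecidableEq ι] [Fintype A]
    [DecidableEq A] (S J : Finset ι) (φ : ι → A → ℂ) (hφ : ∀ i, ∑ a, φ i a = 0) (x : ι → A) :
    ∑ z with ∀ i, i ∉ J → z i = x i, C (pureFun S φ z) * (X : ℂ[X]) ^ hammingDist x z =
      C (pureFun S φ x) *
        krawtchoukPoly (Fintype.card A) (S ∩ J).card (J.card - (S ∩ J).card) := by
  let t : ι → Finset A := fun i => if i ∈ J then Finset.univ else {x i}
  let g : ι → A → ℂ[X] := fun i a =>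
    (if i ∈ S then C (φ i a) else 1) * (if x i ≠ a then X else 1)
  have hset : (Finset.univ.filter fun z : ι → A => ∀ i, i ∉ J → z i = x i) =
      Fintype.piFinset t := by
    ext z
    simp only [Finset.mem_filter_univ, Fintype.mem_piFinset, t]
    refine forall_congr' fun i => ?_
    split_ifs with hi <;> simp [hi]
  have hterm : ∀ z, C (pureFun S φ z) * (X : ℂ[X]) ^ hammingDist x z = ∏ i, g i (z i) := by
    intro z
    simp only [g, Finset.prod_mul_distrib, pureFun, map_prod, hammingDist]
    rw [Finset.prod_ite_mem, Finset.univ_inter, Finset.prod_ite]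
    simp
  have hfactor : ∀ i, ∑ a ∈ t i, g i a = (if i ∈ S then C (φ i (x i)) else 1) *
      ((if i ∈ S ∩ J then 1 - X else 1) *
        (if i ∈ J \ S then 1 + C ((Fintype.card A : ℂ) - 1) * X else 1)) := by
    intro i
    have hite : ∀ a, (if x i ≠ a then X else 1 : ℂ[X]) = X + if x i = a then 1 - X else 0 := by
      intro a; by_cases h : x i = a <;> simp [h]
    by_cases hJ : i ∈ J
    · by_cases hS : i ∈ S
      · have h0 : ∑ a, C (φ i a) = (0 : ℂ[X]) := by rw [← map_sum, hφ, map_zero]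
        simp only [g, hite, mul_add, Finset.sum_add_distrib, if_pos hS, ← Finset.sum_mul]
        simp [t, hJ, hS, h0]
      · simp only [t, g, hJ, hS, hite, Finset.sum_add_distrib, if_true, if_false, one_mul,
          Finset.sum_const, Finset.card_univ, Finset.sum_ite_eq, Finset.mem_univ,
          Finset.mem_inter, Finset.mem_sdiff, and_true, not_false_iff, nsmul_eq_mul]
        simp only [map_sub, map_natCast, map_one]
        ring
    · simp [t, g, hJ]
  rw [hset, Finset.sum_congr rfl fun z _ => hterm z, ← Finset.prod_univ_sum]
  simp only [hfactor, Finset.prod_mul_distrib, Finset.prod_ite_mem, Finset.univ_inter,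
    Finset.prod_const]
  rw [krawtchoukPoly, pureFun, map_prod, Finset.card_sdiff]

theorem sphereSum_pureFun {ι A : Type*} [Fintype ι] [DecidableEq ι] [Fintype A]
    [DecidableEq A] (S J : Finset ι) (φ : ι → A → ℂ) (hφ : ∀ i, ∑ a, φ i a = 0) (j : ℕ) :
    sphereSum J j (pureFun S φ) =
      krawtchouk (Fintype.card A) j (S ∩ J).card J.card • pureFun S φ := by
  ext x
  have h := congrArg (fun p => Polynomial.coeff p j) (sum_pureFun_mul_X_pow S J φ hφ x)
  simp only [Polynomial.finsetSum_coeff, Polynomial.coeff_C_mul, Polynomial.coeff_X_pow,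
    mul_ite, mul_one, mul_zero] at h
  rw [Pi.smul_apply, smul_eq_mul, krawtchouk_eq_coeff, mul_comm, ← h, ← Finset.sum_filter,
    Finset.filter_filter, sphereSum_apply]
  simp only [eq_comm]

/-- The span of the product functions with `w` factors, all of zero sum. -/
def pureSpan (ι A : Type*) [Fintype A] (w : ℕ) : Submodule ℂ ((ι → A) → ℂ) :=
  Submodule.span ℂ {f | ∃ S φ, (∀ i : ι, ∑ a : A, φ i a = 0) ∧ S.card = w ∧ f = pureFun S φ}

theorem pureFun_mem_pureSpan {ι A : Type*} [Fintype A] (S : Finset ι) (φ : ι → A → ℂ)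
    (hφ : ∀ i, ∑ a, φ i a = 0) : pureFun S φ ∈ pureSpan ι A S.card :=
  Submodule.subset_span ⟨S, φ, hφ, rfl, rfl⟩

/-- A point mass is a product of one-coordinate indicators; splitting each into its zero-sum part
plus a constant and expanding gives pure functions. -/
theorem eq_top_of_pureFun_mem {ι A : Type*} [Fintype ι] [DecidableEq ι] [Fintype A]
    [DecidableEq A] [Nonempty A] (V : Submodule ℂ ((ι → A) → ℂ))
    (hV : ∀ S φ, (∀ i : ι, ∑ a : A, φ i a = 0) → pureFun S φ ∈ V) : V = ⊤ := by
  have hA : (Fintype.card A : ℂ) ≠ 0 := Nat.cast_ne_zero.2 Fintype.card_ne_zero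
  have hsingle : ∀ a : ι → A, (Pi.single a 1 : (ι → A) → ℂ) ∈ V := by
    intro a
    let φ : ι → A → ℂ := fun i b => (if b = a i then 1 else 0) - (Fintype.card A : ℂ)⁻¹
    have hφ : ∀ i, ∑ b, φ i b = 0 := by
      intro i
      simp [φ, Finset.sum_sub_distrib, hA]
    have h1 : (Pi.single a 1 : (ι → A) → ℂ) =
        ∑ S, ((Fintype.card A : ℂ)⁻¹ ^ (Sᶜ).card) • pureFun S φ := by
      ext x
      have h2 : (Pi.single a 1 : (ι → A) → ℂ) x =
          ∏ i, (φ i (x i) + (Fintype.card A : ℂ)⁻¹) := by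
        simp only [φ, sub_add_cancel]
        rw [Finset.prod_ite_zero]
        simp [Pi.single_apply, funext_iff]
      rw [h2, Fintype.prod_add, Finset.sum_apply]
      refine Finset.sum_congr rfl fun S _ => ?_
      simp [pureFun, mul_comm]
    rw [h1]
    exact V.sum_mem fun S _ => V.smul_mem _ (hV S φ hφ)
  rw [eq_top_iff]
  intro f _
  rw [pi_eq_sum_univ' f]
  refine V.sum_mem fun a _ => V.smul_mem _ ?_
  convert hsingle a using 1

theorem mem_pureSpan_of_sphereSum_one {ι A : Type*} [Fintype ι] [DecidableEq ι] [Fintype A]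
    [DecidableEq A] [Nonempty A] (h : ℕ) (hh : h ≤ Fintype.card ι) (f : (ι → A) → ℂ)
    (hf : sphereSum Finset.univ 1 f =
      krawtchouk (Fintype.card A) 1 h (Fintype.card ι) • f) :
    f ∈ pureSpan ι A h := by
  set q := Fintype.card A with hq
  set n := Fintype.card ι with hn
  have hq0 : (q : ℂ) ≠ 0 := Nat.cast_ne_zero.2 Fintype.card_ne_zero
  have hval : ∀ w ≤ n, krawtchouk q 1 w n = ((q : ℂ) - 1) * n - q * w := by
    intro w hw
    simp [krawtchouk, Finset.sum_range_succ, Nat.cast_sub hw]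
    ring
  let D : Module.End ℂ ((ι → A) → ℂ) := sphereSum Finset.univ 1
  have heig : ∀ S φ, (∀ i : ι, ∑ a : A, φ i a = 0) →
      pureFun S φ ∈ D.eigenspace (krawtchouk q 1 S.card n) := by
    intro S φ hφ
    rw [Module.End.mem_eigenspace_iff]
    have := sphereSum_pureFun S Finset.univ φ hφ 1
    rwa [Finset.inter_univ] at this
  have hle : pureSpan ι A h ≤ D.eigenspace (krawtchouk q 1 h n) := by
    refine Submodule.span_le.2 ?_
    rintro _ ⟨S, φ, hφ, rfl, rfl⟩
    exact heig S φ hφ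
  have htop : pureSpan ι A h ⊔ ⨆ ν, ⨆ _ : ν ≠ krawtchouk q 1 h n, D.eigenspace ν = ⊤ := by
    refine eq_top_of_pureFun_mem _ fun S φ hφ => ?_
    by_cases hS : S.card = h
    · exact Submodule.mem_sup_left (hS ▸ pureFun_mem_pureSpan S φ hφ)
    · refine Submodule.mem_sup_right (Submodule.mem_iSup_of_mem (krawtchouk q 1 S.card n)
        (Submodule.mem_iSup_of_mem ?_ (heig S φ hφ)))
      rw [hval _ (Finset.card_le_univ S), hval _ hh]
      intro he
      apply hS
      have : (q : ℂ) * S.card = q * h := by linear_combination -he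
      exact_mod_cast mul_left_cancel₀ hq0 this
  -- The part `b` from the other eigenspaces also lies in the eigenspace of `f`, so independence of
  -- eigenspaces kills it.
  obtain ⟨a, ha, b, hb, rfl⟩ := Submodule.mem_sup.1 (htop ▸ Submodule.mem_top : f ∈ _)
  have hb' : b ∈ D.eigenspace (krawtchouk q 1 h n) := by
    have hab : a + b ∈ D.eigenspace (krawtchouk q 1 h n) := Module.End.mem_eigenspace_iff.2 hf
    simpa using Submodule.sub_mem _ hab (hle ha)
  have hb0 : b = 0 :=
    Submodule.disjoint_def.1 (D.eigenspaces_iSupIndep (krawtchouk q 1 h n)) b hb' hb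
  rwa [hb0, add_zero]

/-- Pure functions are eigenvectors with nonzero eigenvalues, so the operator is surjective, hence
injective in finite dimension. -/
theorem eq_zero_of_sum_smul_sphereSum {ι A : Type*} [Fintype ι] [DecidableEq ι] [Fintype A]
    [DecidableEq A] [Nonempty A] (c : ℕ → ℂ) (s : Finset ℕ)
    (hc : ∀ l ≤ Fintype.card ι,
      ∑ i ∈ s, c i * krawtchouk (Fintype.card A) i l (Fintype.card ι) ≠ 0)
    (f : (ι → A) → ℂ) (hf : ∑ i ∈ s, c i • sphereSum Finset.univ i f = 0) : f = 0 := by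
  let T : ((ι → A) → ℂ) →ₗ[ℂ] ((ι → A) → ℂ) := ∑ i ∈ s, c i • sphereSum Finset.univ i
  have hT : T.range = ⊤ := by
    refine eq_top_of_pureFun_mem _ fun S φ hφ => ?_
    have h1 : T (pureFun S φ) =
        (∑ i ∈ s, c i * krawtchouk (Fintype.card A) i S.card (Fintype.card ι)) •
          pureFun S φ := by
      simp only [T, LinearMap.sum_apply, LinearMap.smul_apply, sphereSum_pureFun S _ φ hφ,
        Finset.inter_univ, Finset.card_univ, smul_smul, Finset.sum_smul]
    refine ⟨(∑ i ∈ s, c i * krawtchouk (Fintype.card A) i S.card (Fintype.card ι))⁻¹ •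
      pureFun S φ, ?_⟩
    rw [map_smul, h1, smul_smul, inv_mul_cancel₀ (hc _ (Finset.card_le_univ S)), one_smul]
  have hinj : Function.Injective T :=
    LinearMap.injective_iff_surjective.2 (LinearMap.range_eq_top.1 hT)
  refine hinj ?_
  rw [map_zero, ← hf]
  simp [T]

theorem sphereSum_compl_eq {ι A : Type*} [Fintype ι] [DecidableEq ι] [Fintype A]
    [DecidableEq A] [Nonempty A] {h j : ℕ} (I : Finset ι) (hI : I.card ≤ h)
    (hj : j ≤ Fintype.card ι - I.card) (f : (ι → A) → ℂ) (hf : f ∈ pureSpan ι A h) :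
    sphereSum Iᶜ j f = ∑ i ∈ Finset.range (I.card + 1),
      localCoeff (Fintype.card A) (Fintype.card ι) h I.card i j • sphereSum I i f := by
  have key := LinearMap.eqOn_span' (R := ℂ) (f := sphereSum (A := A) Iᶜ j)
    (g := ∑ i ∈ Finset.range (I.card + 1),
      localCoeff (Fintype.card A) (Fintype.card ι) h I.card i j • sphereSum I i)
    (s := {f | ∃ S φ, (∀ i : ι, ∑ a : A, φ i a = 0) ∧ S.card = h ∧ f = pureFun S φ}) ?_ hf
  · simpa using key
  rintro _ ⟨S, φ, hφ, hS, rfl⟩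
  have hcard : (S ∩ Iᶜ).card = h - (S ∩ I).card := by
    have := Finset.card_sdiff_add_card_inter S I
    rw [Finset.sdiff_eq_inter_compl] at this
    omega
  have hle : (S ∩ Iᶜ).card ≤ Fintype.card ι - I.card := by
    rw [← Finset.card_compl]; exact Finset.card_le_card Finset.inter_subset_right
  simp only [LinearMap.sum_apply, LinearMap.smul_apply, sphereSum_pureFun S _ φ hφ, smul_smul,
    ← Finset.sum_smul]
  rw [sum_localCoeff_mul_krawtchouk _ Fintype.card_pos
    (Finset.card_le_card Finset.inter_subset_right) hI (hcard ▸ hle) (Finset.card_le_univ I) hj,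
    hcard, Finset.card_compl]

/-! ### Words with a fixed support, and induction on weight -/

/-- Extension by zero of a word with nonzero letters indexed by `I`. -/
def extendZero {ι A : Type*} [DecidableEq ι] [Zero A] (I : Finset ι)
    (y : I → {a : A // a ≠ 0}) (i : ι) : A :=
  if hi : i ∈ I then y ⟨i, hi⟩ else 0

theorem extendZero_ne_iff {ι A : Type*} [DecidableEq ι] [Zero A] (I : Finset ι)
    (y z : I → {a : A // a ≠ 0}) (i : ι) :
    extendZero I y i ≠ extendZero I z i ↔ ∃ hi : i ∈ I, y ⟨i, hi⟩ ≠ z ⟨i, hi⟩ := by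
  unfold extendZero
  by_cases hi : i ∈ I <;> simp [hi, Subtype.ext_iff]

theorem hammingDist_extendZero {ι A : Type*} [Fintype ι] [DecidableEq ι] [Zero A]
    [DecidableEq A] (I : Finset ι) (y z : I → {a : A // a ≠ 0}) :
    hammingDist (extendZero I y) (extendZero I z) = hammingDist y z := by
  unfold hammingDist
  rw [← Finset.card_map (Function.Embedding.subtype _)]
  congr 1
  ext i
  simp [extendZero_ne_iff]

/-- Words in the face have support inside `I`; those with smaller support contribute zero by `hf`,
and the others form a cube over the nonzero letters. -/
theorem sphereSum_extendZero {ι A : Type*} [Fintype ι] [DecidableEq ι] [Zero A] [Fintype A]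
    [DecidableEq A] (I : Finset ι) (f : (ι → A) → ℂ)
    (hf : ∀ z, hammingDist z 0 < I.card → f z = 0) (j : ℕ) (y : I → {a : A // a ≠ 0}) :
    sphereSum Finset.univ j (fun z => f (extendZero I z)) y =
      sphereSum I j f (extendZero I y) := by
  rw [sphereSum_apply, sphereSum_apply]
  refine Finset.sum_of_injOn (extendZero I) ?_ ?_ ?_ (fun _ _ => rfl)
  · intro z _ z' _ hzz
    by_contra hne
    rw [← ne_eq, Function.ne_iff] at hne
    obtain ⟨i, hi⟩ := hne
    exact (extendZero_ne_iff I z z' i).2 ⟨i.2, hi⟩ (congrFun hzz i)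
  · intro z hz
    simp only [Finset.coe_filter, Set.mem_ofPred_eq, Finset.mem_univ, true_and] at hz ⊢
    refine ⟨fun i hi => by simp [extendZero, hi], ?_⟩
    rw [hammingDist_extendZero, hz.2]
  · intro z hz hz'
    simp only [Finset.mem_filter_univ] at hz
    refine hf z ?_
    by_contra hlt
    have hsub : (Finset.univ.filter fun i => z i ≠ 0) ⊆ I := by
      intro i hi
      simp only [Finset.mem_filter_univ] at hi
      by_contra hiI
      exact hi (by rw [hz.1 i hiI]; simp [extendZero, hiI])
    have hI := Finset.eq_of_subset_of_card_le hsub (not_lt.1 hlt)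
    have hne : ∀ i ∈ I, z i ≠ 0 := fun i hi => by
      rw [← hI] at hi; simpa using hi
    have hext : extendZero I (fun i => ⟨z i, hne i i.2⟩) = z := by
      ext i
      by_cases hi : i ∈ I
      · simp [extendZero, hi]
      · rw [hz.1 i hi]; simp [extendZero, hi]
    refine hz' ⟨fun i => ⟨z i, hne i i.2⟩, ?_, hext⟩
    simp only [Finset.coe_filter, Set.mem_ofPred_eq, Finset.mem_univ, true_and]
    refine ⟨by simp, ?_⟩
    rw [← hammingDist_extendZero, hext, hz.2]

theorem eq_zero_of_mem_pureSpan {ι A : Type*} [Fintype ι] [DecidableEq ι] [Zero A] [Fintype A]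
    [DecidableEq A] (hA : 1 < Fintype.card A) {h d : ℕ} (hd : d ≤ h)
    (hcond : ∀ k ≤ d, ∀ l ≤ k, ∑ i ∈ Finset.range (k + 1),
      localCoeff (Fintype.card A) (Fintype.card ι) h k i (d - k) *
        krawtchouk (Fintype.card A - 1) i l k ≠ 0)
    (hdn : d ≤ Fintype.card ι) (f : (ι → A) → ℂ) (hf : f ∈ pureSpan ι A h)
    (hf0 : ∀ x, hammingDist x 0 = d → f x = 0) (x : ι → A) (hx : hammingDist x 0 ≤ d) :
    f x = 0 := by
  have : Nontrivial A := Fintype.one_lt_card_iff_nontrivial.1 hA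
  obtain ⟨a, ha⟩ := exists_ne (0 : A)
  have : Nonempty {a : A // a ≠ 0} := ⟨⟨a, ha⟩⟩
  have hB : Fintype.card {a : A // a ≠ 0} = Fintype.card A - 1 := by
    simp [Fintype.card_subtype_compl]
  induction hk : hammingDist x 0 using Nat.strong_induction_on generalizing x with
  | _ k ih =>
  have ih' : ∀ z, hammingDist z 0 < k → f z = 0 := fun z hz => ih _ hz z (by omega) rfl
  let I : Finset ι := Finset.univ.filter fun i => x i ≠ 0
  have hI : I.card = k := hk
  have hne : ∀ i ∈ I, x i ≠ 0 := fun i hi => (Finset.mem_filter_univ i).1 hi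
  have hext : extendZero I (fun i => ⟨x i, hne i i.2⟩) = x := by
    ext i
    by_cases hi : x i = 0 <;> simp [extendZero, I, hi]
  rw [← hext]
  refine congrFun (eq_zero_of_sum_smul_sphereSum
    (fun i => localCoeff (Fintype.card A) (Fintype.card ι) h k i (d - k))
    (Finset.range (k + 1)) ?_ (fun z => f (extendZero I z)) ?_) _
  · intro l hl
    rw [Fintype.card_coe, hI] at hl
    simp only [hB, Fintype.card_coe, hI]
    exact hcond k (hk ▸ hx) l hl
  · ext y
    have hloc := congrFun (sphereSum_compl_eq (h := h) (j := d - k) I (by omega) (by omega) f hf)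
      (extendZero I y)
    rw [hI] at hloc
    simp only [Finset.sum_apply, Pi.smul_apply] at hloc ⊢
    simp only [sphereSum_extendZero I f (hI.symm ▸ ih')]
    rw [← hloc, sphereSum_apply]
    refine Finset.sum_eq_zero fun z hz => hf0 z ?_
    simp only [Finset.mem_filter_univ, Finset.mem_compl, not_not] at hz
    -- `z` alters the word only outside `I`, at `d - k` positions where it was zero, so `z` has
    -- weight `d`.
    have hdisj : Disjoint I (Finset.univ.filter fun i => extendZero I y i ≠ z i) := by
      rw [Finset.disjoint_left]
      intro i hi
      simp [hz.1 i hi]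
    have hsplit : (Finset.univ.filter fun i => z i ≠ 0) = I.disjUnion _ hdisj := by
      ext i
      simp only [Finset.mem_filter_univ, Finset.mem_disjUnion]
      by_cases hi : i ∈ I
      · rw [hz.1 i hi]
        simpa [extendZero, hi] using (y ⟨i, hi⟩).2
      · simp [extendZero, hi, eq_comm]
    have hcard : hammingDist z 0 = I.card + hammingDist (extendZero I y) z := by
      rw [hammingDist, hammingDist, ← Finset.card_disjUnion _ _ hdisj, ← hsplit]
      rfl
    omega

/-- Write `λ_h = (q-1)n - qh` for the eigenvalue with index `h`. Under the numerical conditions,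
the values `φ` of a `λ_h`-function on the sphere of radius `d ≤ h` determine its value at every
vertex of the ball of radius `d`. -/
theorem theorem2 (q n : ℕ) [NeZero q] (hq : 2 < q) (h d : ℕ) (hhn : h ≤ n) (hdh : d ≤ h)
    (μ : ℂ) (hμ : μ = ((q : ℂ) - 1) * (n : ℂ) - (q : ℂ) * (h : ℂ))
    (hcond : ∀ k : ℕ, k ≤ d → ∀ l : ℕ, l ≤ k →
      ∑ i ∈ Finset.range (k + 1),
        localCoeff q n h k i (d - k) * krawtchouk (q - 1) i l k ≠ 0)
    (φ : zeroSphere q n d → ℂ)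
    (f g : (Fin n → ZMod q) → ℂ)
    (hf : IsEigenfunction q n μ f) (hg : IsEigenfunction q n μ g)
    (hfφ : ∀ α : zeroSphere q n d, f α = φ α) (hgφ : ∀ α : zeroSphere q n d, g α = φ α) :
    ∀ α ∈ zeroBall q n d, f α = g α := by
  intro α hα
  have hkr : krawtchouk q 1 h n = μ := by
    simp [hμ, krawtchouk, Finset.sum_range_succ, Nat.cast_sub hhn]
    ring
  have hD : ∀ u, IsEigenfunction q n μ u → sphereSum Finset.univ 1 u = μ • u := by
    intro u hu
    rw [← hu]
    ext x
    simp only [sphereSum_apply, Matrix.mulVec, dotProduct, SimpleGraph.adjMatrix_apply,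
      Finset.sum_filter, ite_mul, one_mul, zero_mul]
    simp only [qaryCube, Finset.mem_univ, not_true, false_imp_iff, implies_true, true_and]
    congr!
  have hmem : f - g ∈ pureSpan (Fin n) (ZMod q) h := by
    refine mem_pureSpan_of_sphereSum_one h (by simpa using hhn) _ ?_
    rw [map_sub, hD f hf, hD g hg, ZMod.card, Fintype.card_fin, hkr, smul_sub]
  refine sub_eq_zero.1 (eq_zero_of_mem_pureSpan (d := d) (by rw [ZMod.card]; omega) hdh ?_
    (by rw [Fintype.card_fin]; omega) (f - g) hmem ?_ α hα)
  · simpa only [ZMod.card, Fintype.card_fin] using hcond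
  · intro x hx
    rw [Pi.sub_apply, hfφ ⟨x, hx⟩, hgφ ⟨x, hx⟩, sub_self]
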